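/- Let $X$ be a finite-dimensional real normed space of dimension $d$, and let $\mathrm{Iso}(X)$ be its group of isometries, a closed Lie subgroup of the group of invertible affine maps of $X$ (all isometries are affine); $\dim \mathrm{Iso}(X)$ denotes its dimension as a Lie group, i.e. the dimension of its tangent space at the identity. A support functional of $x\in X$ is an $f\in X^*$ with $\|f\|=\|x\|$ and $f(x)=\|x\|^2$; a point $x\neq 0$ is smooth if it has exactly one support functional, which is then denoted $\varphi(x)$. A framework $(G,p)$ consists of a simple graph $G$ and a map $p:V(G)\to X$, $v\mapsto p_v$. It is well-positioned if $p_v-p_w$ is smooth for every edge $vw$ of $G$. In that case its rigidity operator is the linear map $$df_G(p): X^{V(G)}\to\mathbb{R}^{E(G)},\qquad (x_v)_v\mapsto \left(\varphi\!\left(\tfrac{p_v-p_w}{\|p_v-p_w\|}\right)(x_v-x_w)\right)_{vw\in E(G)} .$$ A well-positioned framework is independent if $df_G(p)$ is surjective. A trivial motion of $p$ is a $u\in X^{V(G)}$ for which there are $\delta>0$ and continuous paths $\alpha_v:(-\delta,\delta)\to X$ ($v \in V(G)$), differentiable at $0$, with $\alpha_v(0)=p_v$ and $\alpha_v'(0)=u_v$,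 such that for each $t$ there is $g\in\mathrm{Iso}(X)$ with $\alpha_v(t)=g(p_v)$ for all $v$. A well-positioned framework is infinitesimally rigid if every $u\in\ker df_G(p)$ is a trivial motion of $p$, and isostatic if it is infinitesimally rigid and independent. Let $(G,p)$ be an independent framework in $X$ with $G$ finite and $|V(G)|\geq d+1$. Then every (not necessarily induced) subgraph $H\subseteq G$ with $|V(H)|\geq d+1$ satisfies $$|E(H)|\leq d\,|V(H)|-\dim\mathrm{Iso}(X).$$ If $(G,p)$ is moreover isostatic, then $$|E(G)|=d\,|V(G)|-\dim\mathrm{Iso}(X).$$ -/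

import Mathlib

namespace NormedRigidity

noncomputable section

section Duality

variable {X : Type*} [NormedAddCommGroup X] [NormedSpace ℝ X]

/-- The functional `f` is a support functional of `x`. -/
def IsSupportFunctional (x : X) (f : X →L[ℝ] ℝ) : Prop :=
  ‖f‖ = ‖x‖ ∧ f x = ‖x‖ ^ 2

/-- A point is smooth if it is non-zero and has exactly one support functional. -/
def IsSmoothPoint (x : X) : Prop :=
  x ≠ 0 ∧ ∃! f : X →L[ℝ] ℝ, IsSupportFunctional x f

open Classical in
/-- The dual map `φ`, sending a smooth point to its unique support functional and `0` to `0`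
(elsewhere it takes the irrelevant value `0`). -/
def dualMap (x : X) : X →L[ℝ] ℝ :=
  if h : IsSmoothPoint x then h.2.exists.choose else 0

theorem dualMap_spec {x : X} (h : IsSmoothPoint x) : IsSupportFunctional x (dualMap x) := by
  rw [dualMap, dif_pos h]
  exact h.2.exists.choose_spec

theorem dualMap_zero : dualMap (0 : X) = 0 := by
  rw [dualMap, dif_neg (fun h => h.1 rfl)]

theorem IsSupportFunctional.neg {x : X} {f : X →L[ℝ] ℝ} (h : IsSupportFunctional x f) :
    IsSupportFunctional (-x) (-f) := by
  refine ⟨by rw [norm_neg, norm_neg, h.1], ?_⟩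
  rw [norm_neg, ← h.2]
  simp

theorem IsSmoothPoint.neg {x : X} (h : IsSmoothPoint x) : IsSmoothPoint (-x) := by
  obtain ⟨h0, f, hf, hu⟩ := h
  refine ⟨neg_ne_zero.mpr h0, -f, hf.neg, fun g hg => ?_⟩
  have h1 : IsSupportFunctional x (-g) := by
    have h2 := hg.neg
    rwa [neg_neg] at h2
  rw [← hu _ h1, neg_neg]

theorem dualMap_neg (x : X) : dualMap (-x) = -dualMap x := by
  by_cases h : IsSmoothPoint x
  · exact h.neg.2.unique (dualMap_spec h.neg) (dualMap_spec h).neg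
  · have h' : ¬ IsSmoothPoint (-x) := fun hn => h (by simpa using hn.neg)
    rw [dualMap, dif_neg h', dualMap, dif_neg h, neg_zero]

end Duality

section Frameworks

variable {X : Type*} [NormedAddCommGroup X] [NormedSpace ℝ X] {V : Type*}

/-- The framework `(G, p)` is well-positioned. -/
def IsWellPositioned (G : SimpleGraph V) (p : V → X) : Prop :=
  ∀ v w : V, G.Adj v w → IsSmoothPoint (p v - p w)

/-- The functional `φ_{v,w} = φ((p_v - p_w) / ‖p_v - p_w‖)`. -/
def edgeFunctional (p : V → X) (v w : V) : X →L[ℝ] ℝ :=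
  dualMap (‖p v - p w‖⁻¹ • (p v - p w))

/-- The entry `φ_{v,w}(x_v - x_w)` of the rigidity operator at the unordered pair `vw`. -/
def rigidityEntry (p x : V → X) : Sym2 V → ℝ :=
  Sym2.lift ⟨fun v w => edgeFunctional p v w (x v - x w), fun v w => by
    have h : edgeFunctional p w v = -edgeFunctional p v w := by
      rw [edgeFunctional, edgeFunctional, ← dualMap_neg, ← smul_neg, neg_sub, norm_sub_rev]
    simp only [h, map_sub, neg_apply]
    ring⟩

/-- The rigidity operator of `G` at `p`. -/
def rigidityOperator (G : SimpleGraph V) (p : V → X) : (V → X) →ₗ[ℝ] (G.edgeSet → ℝ) where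
  toFun x := fun e => rigidityEntry p x e
  map_add' x y := by
    ext ⟨e, he⟩
    induction e using Sym2.ind with
    | _ v w => simp [rigidityEntry]; ring
  map_smul' c x := by
    ext ⟨e, he⟩
    induction e using Sym2.ind with
    | _ v w => simp [rigidityEntry]; ring

/-- The vector `u` is an infinitesimal flex of `(G, p)`. -/
def IsFlex (G : SimpleGraph V) (p u : V → X) : Prop :=
  rigidityOperator G p u = 0

/-- The orbit of the placement `p` under the isometry group of `X`. -/
def orbit (p : V → X) : Set (V → X) :=
  {q | ∃ g : X ≃ᵢ X, ∀ v, q v = g (p v)}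

/-- The family `α` restricts on `(-δ, δ)` to a trivial finite motion of the placement `p`. -/
def IsTrivialFiniteMotion (p : V → X) (δ : ℝ) (α : V → ℝ → X) : Prop :=
  0 < δ ∧ (∀ v, ContinuousOn (α v) (Set.Ioo (-δ) δ)) ∧ (∀ v, α v 0 = p v) ∧
    ∀ t ∈ Set.Ioo (-δ) δ, (fun v => α v t) ∈ orbit p

/-- The vector `u` is a trivial infinitesimal motion of `p`. -/
def IsTrivialMotion (p u : V → X) : Prop :=
  ∃ (δ : ℝ) (α : V → ℝ → X), IsTrivialFiniteMotion p δ α ∧ ∀ v, HasDerivAt (α v) (u v) 0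

/-- The framework `(G, p)` is (well-positioned and) infinitesimally rigid. -/
def IsInfinitesimallyRigid (G : SimpleGraph V) (p : V → X) : Prop :=
  IsWellPositioned G p ∧ ∀ u : V → X, IsFlex G p u → IsTrivialMotion p u

/-- The framework `(G, p)` is (well-positioned and) independent. -/
def IsIndependent (G : SimpleGraph V) (p : V → X) : Prop :=
  IsWellPositioned G p ∧ Function.Surjective (rigidityOperator G p)

/-- The framework `(G, p)` is isostatic. -/
def IsIsostatic (G : SimpleGraph V) (p : V → X) : Prop :=
  IsInfinitesimallyRigid G p ∧ IsIndependent G p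

end Frameworks

section IsometryGroup

variable (X : Type*) [NormedAddCommGroup X] [NormedSpace ℝ X]

/-- The isometry group of `X` as a subset of the normed space of continuous affine maps `X → X`;
every isometry is affine by the Mazur-Ulam theorem. -/
def isoGroup : Set (X →ᴬ[ℝ] X) :=
  Set.range fun g : X ≃ᵢ X =>
    g.toRealAffineIsometryEquiv.toContinuousAffineEquiv.toContinuousAffineMap

/-- The tangent space at the identity of the isometry group, an embedded submanifold of the space
of affine maps: the velocities at `0` of smooth curves in the group through the identity. These
already form a linear subspace; the span only serves to bundle it. -/
def isoTangentSpace : Submodule ℝ (X →ᴬ[ℝ] X) :=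
  Submodule.span ℝ {A | ∃ (δ : ℝ) (γ : ℝ → (X →ᴬ[ℝ] X)), 0 < δ ∧
    ContDiffOn ℝ (⊤ : ℕ∞) γ (Set.Ioo (-δ) δ) ∧ (∀ t ∈ Set.Ioo (-δ) δ, γ t ∈ isoGroup X) ∧
    γ 0 = ContinuousAffineMap.id ℝ X ∧ HasDerivAt γ A 0}

/-- The dimension of the isometry group of `X` as a Lie group. -/
def dimIso : ℕ :=
  Module.finrank ℝ (isoTangentSpace X)

end IsometryGroup

end

end NormedRigidity

open Filter Topology

namespace NormedRigidity

section Duality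

variable {X : Type*} [NormedAddCommGroup X] [NormedSpace ℝ X]

theorem IsSupportFunctional.smul {x : X} {f : X →L[ℝ] ℝ} (h : IsSupportFunctional x f) {c : ℝ}
    (hc : 0 < c) : IsSupportFunctional (c • x) (c • f) := by
  refine ⟨by rw [norm_smul, norm_smul, h.1], ?_⟩
  have h2 := h.2
  simp only [map_smul, smul_apply, smul_eq_mul, norm_smul, Real.norm_eq_abs, abs_of_pos hc, h2]
  ring

theorem IsSmoothPoint.smul {x : X} (h : IsSmoothPoint x) {c : ℝ} (hc : 0 < c) :
    IsSmoothPoint (c • x) := by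
  obtain ⟨h0, f, hf, hu⟩ := h
  refine ⟨smul_ne_zero hc.ne' h0, c • f, hf.smul hc, fun g hg => ?_⟩
  have h1 := hg.smul (inv_pos.mpr hc)
  rw [inv_smul_smul₀ hc.ne'] at h1
  rw [← hu _ h1, smul_inv_smul₀ hc.ne']

theorem exists_isSupportFunctional (x : X) : ∃ f : X →L[ℝ] ℝ, IsSupportFunctional x f := by
  by_cases hx : x = 0
  · exact ⟨0, by simp [IsSupportFunctional, hx]⟩
  · obtain ⟨g, hg, hgx⟩ := exists_dual_vector ℝ x (norm_ne_zero_iff.mpr hx)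
    refine ⟨‖x‖ • g, by simp [norm_smul, hg], ?_⟩
    have : g x = ‖x‖ := hgx
    simp [this, sq]

theorem isSmoothPoint_of_differentiableAt {x : X} (hx : x ≠ 0)
    (h : DifferentiableAt ℝ (fun y : X => ‖y‖) x) : IsSmoothPoint x := by
  have key : ∀ f : X →L[ℝ] ℝ, IsSupportFunctional x f →
      f = ‖x‖ • fderiv ℝ (fun y : X => ‖y‖) x := by
    intro f hf
    have hmin : IsLocalMin (fun y : X => ‖x‖ * ‖y‖ - f y) x := by
      refine Eventually.of_forall fun y => ?_
      have h1 : f y ≤ ‖f‖ * ‖y‖ := (le_abs_self _).trans (f.le_opNorm y)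
      have h2 := hf.2
      rw [hf.1] at h1
      simp only
      nlinarith
    have hd : HasFDerivAt (fun y : X => ‖x‖ * ‖y‖ - f y)
        (‖x‖ • fderiv ℝ (fun y : X => ‖y‖) x - f) x :=
      (h.hasFDerivAt.const_mul ‖x‖).sub f.hasFDerivAt
    exact (sub_eq_zero.mp (hmin.hasFDerivAt_eq_zero hd)).symm
  obtain ⟨f, hf⟩ := exists_isSupportFunctional x
  exact ⟨hx, f, hf, fun g hg => (key g hg).trans (key f hf).symm⟩

theorem tendsto_dualMap [FiniteDimensional ℝ X] {x : X} (hx : IsSmoothPoint x) :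
    Tendsto dualMap (𝓝[{y | IsSmoothPoint y}] x) (𝓝 (dualMap x)) := by
  have hn : Tendsto (fun y : X => ‖y‖) (𝓝[{y | IsSmoothPoint y}] x) (𝓝 ‖x‖) :=
    tendsto_nhdsWithin_of_tendsto_nhds continuous_norm.continuousAt
  have hS : ∀ᶠ y in 𝓝[{y | IsSmoothPoint y}] x, IsSmoothPoint y := eventually_mem_nhdsWithin
  refine (isCompact_closedBall (0 : X →L[ℝ] ℝ) (‖x‖ + 1)).tendsto_nhds_of_unique_mapClusterPt
    ?_ fun f _ hf => ?_
  · filter_upwards [hS, hn.eventually (gt_mem_nhds (lt_add_one ‖x‖))] with y hy hy'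
    rw [mem_closedBall_zero_iff, (dualMap_spec hy).1]
    exact hy'.le
  · obtain ⟨U, hU, hUf⟩ := mapClusterPt_iff_ultrafilter.mp hf
    refine hx.2.unique ⟨?_, ?_⟩ (dualMap_spec hx)
    · refine tendsto_nhds_unique (hUf.norm) ((hn.mono_left hU).congr' ?_)
      filter_upwards [hU hS] with y hy
      exact (dualMap_spec hy).1.symm
    · have hid : Tendsto (fun y : X => y) (U : Filter X) (𝓝 x) := hU.trans nhdsWithin_le_nhds
      have h1 : Tendsto (fun y => dualMap y y) (U : Filter X) (𝓝 (f x)) :=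
        (isBoundedBilinearMap_apply.continuous.tendsto (f, x)).comp (hUf.prodMk_nhds hid)
      refine tendsto_nhds_unique h1 (((hn.mono_left hU).pow 2).congr' ?_)
      filter_upwards [hU hS] with y hy
      exact (dualMap_spec hy).2.symm

end Duality

section Placements

variable {X : Type*} [NormedAddCommGroup X] [NormedSpace ℝ X] {V : Type*}

theorem isSmoothPoint_normalize {x : X} (hx : IsSmoothPoint x) :
    IsSmoothPoint (‖x‖⁻¹ • x) :=
  hx.smul (inv_pos.mpr (norm_pos_iff.mpr hx.1))

theorem tendsto_edgeFunctional [FiniteDimensional ℝ X] {G : SimpleGraph V} {p : V → X}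
    (hp : IsWellPositioned G p) {v w : V} (h : G.Adj v w) :
    Tendsto (fun q : V → X => edgeFunctional q v w) (𝓝[{q | IsWellPositioned G q}] p)
      (𝓝 (edgeFunctional p v w)) := by
  refine (tendsto_dualMap (isSmoothPoint_normalize (hp v w h))).comp
    (tendsto_nhdsWithin_iff.mpr ⟨tendsto_nhdsWithin_of_tendsto_nhds ?_, ?_⟩)
  · have h0 : ‖p v - p w‖ ≠ 0 := norm_ne_zero_iff.mpr (hp v w h).1
    have h1 : ContinuousAt (fun q : V → X => q v - q w) p := by fun_prop
    exact (h1.norm.inv₀ h0).smul h1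
  · filter_upwards [eventually_mem_nhdsWithin] with q hq
    exact isSmoothPoint_normalize (hq v w h)

theorem rigidityOperator_apply (G : SimpleGraph V) (p x : V → X) (v w : V)
    (h : s(v, w) ∈ G.edgeSet) :
    rigidityOperator G p x ⟨s(v, w), h⟩ = edgeFunctional p v w (x v - x w) := rfl

theorem tendsto_rigidityOperator [FiniteDimensional ℝ X] {G : SimpleGraph V} {p : V → X}
    (hp : IsWellPositioned G p) (x : V → X) :
    Tendsto (fun q : V → X => rigidityOperator G q x) (𝓝[{q | IsWellPositioned G q}] p)
      (𝓝 (rigidityOperator G p x)) := by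
  refine tendsto_pi_nhds.mpr fun ⟨e, he⟩ => ?_
  induction e using Sym2.ind with
  | _ v w =>
    simp only [rigidityOperator_apply]
    exact ((ContinuousLinearMap.apply ℝ ℝ (x v - x w)).continuous.tendsto _).comp
      (tendsto_edgeFunctional hp he)

theorem IsIndependent.eventually [FiniteDimensional ℝ X] [Finite V] {G : SimpleGraph V}
    {p : V → X} (hp : IsIndependent G p) :
    ∀ᶠ q in 𝓝[{q | IsWellPositioned G q}] p, IsIndependent G q := by
  classical
  have : Fintype V := Fintype.ofFinite V
  have : Fintype G.edgeSet := Fintype.ofFinite _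
  choose x hx using fun e : G.edgeSet => hp.2 (Pi.basisFun ℝ G.edgeSet e)
  have hli : LinearIndependent ℝ fun e => rigidityOperator G p (x e) := by
    simp only [hx]
    exact (Pi.basisFun ℝ G.edgeSet).linearIndependent
  have ht : Tendsto (fun q : V → X => fun e => rigidityOperator G q (x e))
      (𝓝[{q | IsWellPositioned G q}] p) (𝓝 fun e => rigidityOperator G p (x e)) :=
    tendsto_pi_nhds.mpr fun e => tendsto_rigidityOperator hp.1 (x e)
  filter_upwards [eventually_mem_nhdsWithin, ht.eventually
    (isOpen_setOfPred_linearIndependent.mem_nhds hli)] with q hq hq'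
  refine ⟨hq, LinearMap.range_eq_top.mp (top_le_iff.mp ?_)⟩
  have hspan := LinearIndependent.span_eq_top_of_card_eq_finrank' hq' (by simp)
  rw [← hspan, Submodule.span_le]
  rintro _ ⟨e, rfl⟩
  exact ⟨x e, rfl⟩

theorem differentiableAt_norm_of_differentiableAt_dist [Fintype V] {q : V → X} {v w : V}
    (hvw : v ≠ w) (h : DifferentiableAt ℝ (fun r : V → X => ‖r v - r w‖) q) :
    DifferentiableAt ℝ (fun y : X => ‖y‖) (q v - q w) := by
  classical
  let s : X → V → X := fun y => Function.update q v (y + q w)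
  have hs : DifferentiableAt ℝ s (q v - q w) := by
    refine differentiableAt_pi.mpr fun u => ?_
    by_cases hu : u = v
    · subst hu
      simp only [s, Function.update_self]
      fun_prop
    · simp only [s, Function.update_of_ne hu]
      fun_prop
  have hsq : s (q v - q w) = q := by simp [s]
  rw [← hsq] at h
  have := h.comp _ hs
  refine this.congr_of_eventuallyEq (Eventually.of_forall fun y => ?_)
  simp [s, Function.update_of_ne hvw.symm]

theorem dense_setOf_differentiableAt_dist [FiniteDimensional ℝ X] [Fintype V] :
    Dense {q : V → X | ∀ v w, DifferentiableAt ℝ (fun r : V → X => ‖r v - r w‖) q} := by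
  let : MeasurableSpace (V → X) := borel _
  have : BorelSpace (V → X) := ⟨rfl⟩
  refine MeasureTheory.Measure.dense_of_ae (μ := MeasureTheory.Measure.addHaar) ?_
  rw [MeasureTheory.ae_all_iff]
  intro v
  rw [MeasureTheory.ae_all_iff]
  intro w
  have hL : LipschitzWith (1 + 1) (fun r : V → X => r v - r w) :=
    (LipschitzWith.eval v).sub (LipschitzWith.eval w)
  exact (lipschitzWith_one_norm.comp hL).ae_differentiableAt

theorem exists_isWellPositioned_mem [FiniteDimensional ℝ X] [Finite V] {G : SimpleGraph V}
    {p : V → X} (hp : IsWellPositioned G p) {U : Set (V → X)} (hU : IsOpen U)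
    (hpU : p ∈ closure U) {N : Set (V → X)} (hN : N ∈ 𝓝[{q | IsWellPositioned G q}] p) :
    ∃ q ∈ N ∩ U, IsWellPositioned G q := by
  have : Fintype V := Fintype.ofFinite V
  obtain ⟨W, hW, hpW, hWN⟩ := mem_nhdsWithin.mp hN
  let D : Set (V → X) := ⋂ v, ⋂ w, {q | G.Adj v w → q v - q w ≠ 0}
  have hD : IsOpen D := by
    refine isOpen_iInter_of_finite fun v => isOpen_iInter_of_finite fun w => ?_
    by_cases h : G.Adj v w
    · simp only [h, true_imp_iff]
      exact isOpen_ne_fun (by fun_prop) (by fun_prop)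
    · simp [h]
  have hpD : p ∈ D := by
    simp only [D, Set.mem_iInter]
    exact fun v w h => (hp v w h).1
  obtain ⟨r, hr, hrU⟩ := mem_closure_iff.mp hpU (W ∩ D) (hW.inter hD) ⟨hpW, hpD⟩
  obtain ⟨q, hq, hq'⟩ := dense_setOf_differentiableAt_dist.inter_open_nonempty _
    ((hW.inter hD).inter hU) ⟨r, hr, hrU⟩
  have hwp : IsWellPositioned G q := by
    intro v w h
    have h0 := hq.1.2
    simp only [D, Set.mem_iInter] at h0
    exact isSmoothPoint_of_differentiableAt (h0 v w h)
      (differentiableAt_norm_of_differentiableAt_dist h.ne (hq' v w))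
  exact ⟨q, ⟨hWN ⟨hq.1.1, hwp⟩, hq.2⟩, hwp⟩

/-- The endomorphism sending the `i`-th basis vector to `q (j (some i)) - q (j none)`. -/
noncomputable def frameMap {ι : Type*} [Fintype ι] (b : Module.Basis ι ℝ X) (j : Option ι → V)
    [FiniteDimensional ℝ X] (q : V → X) : X →L[ℝ] X :=
  ∑ i, (b.coord i).toContinuousLinearMap.smulRight (q (j (some i)) - q (j none))

theorem frameMap_mem_span {ι : Type*} [Fintype ι] [FiniteDimensional ℝ X]
    (b : Module.Basis ι ℝ X) (j : Option ι → V) (q : V → X) (x : X) :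
    frameMap b j q x ∈ Submodule.span ℝ (Set.range fun i => q (j (some i)) - q (j none)) := by
  simp only [frameMap, sum_apply, ContinuousLinearMap.smulRight_apply]
  exact Submodule.sum_mem _ fun i _ => Submodule.smul_mem _ _ (Submodule.subset_span ⟨i, rfl⟩)

theorem eq_zero_of_isUnit_frameMap {ι : Type*} [Fintype ι] [FiniteDimensional ℝ X]
    {b : Module.Basis ι ℝ X} {j : Option ι → V} {q : V → X} (h : IsUnit (frameMap b j q))
    {A : X →ᴬ[ℝ] X} (hA : ∀ v, A (q v) = 0) : A = 0 := by
  have hlin : A.contLinear = 0 := by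
    ext x
    obtain ⟨u, hu⟩ := h
    have hx : x = frameMap b j q ((↑u⁻¹ : X →L[ℝ] X) x) := by
      rw [← hu, ← mul_apply_eq_comp, Units.mul_inv, one_apply_eq_self]
    have hle : Submodule.span ℝ (Set.range fun i => q (j (some i)) - q (j none)) ≤
        LinearMap.ker A.contLinear.toLinearMap := by
      rw [Submodule.span_le]
      rintro _ ⟨i, rfl⟩
      have := A.contLinear_map_vsub (q (j (some i))) (q (j none))
      simp only [vsub_eq_sub, hA, sub_zero] at this
      exact this
    rw [hx]
    exact hle (frameMap_mem_span b j q _)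
  ext x
  have := A.map_vadd (q (j none)) (x - q (j none))
  simpa [hlin, hA] using this

theorem isOpen_setOf_isUnit_frameMap {ι : Type*} [Fintype ι] [FiniteDimensional ℝ X]
    (b : Module.Basis ι ℝ X) (j : Option ι → V) : IsOpen {q : V → X | IsUnit (frameMap b j q)} := by
  have : CompleteSpace X := FiniteDimensional.complete ℝ X
  refine (Units.isOpen (R := X →L[ℝ] X)).preimage ?_
  refine continuous_finsetSum _ fun i _ => ?_
  exact (ContinuousLinearMap.smulRightL ℝ X X (b.coord i).toContinuousLinearMap).continuous.comp
    (by fun_prop)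

theorem isUnit_of_injective [FiniteDimensional ℝ X] {T : X →L[ℝ] X} (h : Function.Injective T) :
    IsUnit T := by
  have h1 : IsUnit (T : X →ₗ[ℝ] X) :=
    (LinearMap.isUnit_iff_ker_eq_bot _).mpr (LinearMap.ker_eq_bot.mpr h)
  exact h1.map (Module.End.toContinuousLinearMap X)

theorem dense_setOf_isUnit_frameMap {ι : Type*} [Fintype ι] [FiniteDimensional ℝ X]
    (b : Module.Basis ι ℝ X) (j : Option ι ↪ V) : Dense {q : V → X | IsUnit (frameMap b j q)} := by
  classical
  intro p
  let e : V → X := Function.extend j (fun o => o.elim 0 b) 0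
  have hfm : ∀ s : ℝ, frameMap b j (p + s • e) = frameMap b j p + s • 1 := by
    intro s
    ext x
    have hb : ∑ i, b.repr x i • b i = x := b.sum_repr x
    have he : ∀ o, e (j o) = o.elim 0 b := fun o => j.injective.extend_apply _ _ o
    simp only [frameMap, Pi.add_apply, Pi.smul_apply, he, sum_apply,
      ContinuousLinearMap.smulRight_apply, add_apply, smul_apply,
      one_apply_eq_self, Option.elim_some, Option.elim_none, smul_zero, add_zero]
    conv_rhs => enter [2]; rw [← hb]
    rw [Finset.smul_sum, ← Finset.sum_add_distrib]
    refine Finset.sum_congr rfl fun i _ => ?_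
    simp only [LinearMap.coe_toContinuousLinearMap', Module.Basis.coord_apply]
    module
  have hfin : (spectrum ℝ (frameMap b j p)).Finite := by
    refine (Module.End.finite_spectrum (frameMap b j p : X →ₗ[ℝ] X)).subset fun s hs => ?_
    refine fun hu => hs ?_
    refine isUnit_of_injective ?_
    have := LinearMap.ker_eq_bot.mp ((LinearMap.isUnit_iff_ker_eq_bot _).mp hu)
    exact this
  have hcont : Tendsto (fun s : ℝ => p + s • e) (𝓝[≠] 0) (𝓝 p) := by
    have : ContinuousAt (fun s : ℝ => p + s • e) 0 := by fun_prop
    simpa [ContinuousAt] using this.tendsto.mono_left nhdsWithin_le_nhds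
  refine mem_closure_of_tendsto hcont ?_
  have hfin' : (Neg.neg ⁻¹' spectrum ℝ (frameMap b j p)).Finite :=
    hfin.preimage neg_injective.injOn
  filter_upwards [nhdsNE_le_cofinite 0 hfin'.compl_mem_cofinite] with s hs
  have hs' : IsUnit (algebraMap ℝ (X →L[ℝ] X) (-s) - frameMap b j p) := by
    by_contra hc
    exact (Set.mem_compl_iff _ _).mp hs hc
  rw [hfm]
  have := hs'.neg
  rw [neg_sub, map_neg, sub_neg_eq_add, Algebra.algebraMap_eq_smul_one] at this
  exact this

theorem IsIndependent.exists_affinely_spanning [FiniteDimensional ℝ X] [Finite V]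
    {G : SimpleGraph V} {p : V → X} (hp : IsIndependent G p)
    (hV : Module.finrank ℝ X + 1 ≤ Nat.card V) :
    ∃ q : V → X, IsIndependent G q ∧ ∀ A : X →ᴬ[ℝ] X, (∀ v, A (q v) = 0) → A = 0 := by
  have : Fintype V := Fintype.ofFinite V
  obtain ⟨j⟩ : Nonempty (Option (Fin (Module.finrank ℝ X)) ↪ V) := by
    refine Function.Embedding.nonempty_of_card_le ?_
    simpa [Nat.card_eq_fintype_card] using hV
  let b := Module.finBasis ℝ X
  obtain ⟨q, hq, -⟩ := exists_isWellPositioned_mem hp.1 (isOpen_setOf_isUnit_frameMap b j)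
    (dense_setOf_isUnit_frameMap b j p) hp.eventually
  exact ⟨q, hq.1, fun A hA => eq_zero_of_isUnit_frameMap hq.2 hA⟩

end Placements

section UpperBound

variable {X : Type*} [NormedAddCommGroup X] [NormedSpace ℝ X] {V : Type*}

theorem hasDerivAt_apply_of_hasDerivAt {γ : ℝ → (X →ᴬ[ℝ] X)} {A : X →ᴬ[ℝ] X} {t : ℝ}
    (h : HasDerivAt γ A t) (x : X) : HasDerivAt (fun s => γ s x) (A x) t := by
  let L : (X →ᴬ[ℝ] X) →L[ℝ] X :=
    LinearMap.mkContinuous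
      { toFun := fun f => f x, map_add' := fun _ _ => rfl, map_smul' := fun _ _ => rfl }
      (‖x‖ + 1) fun f => by
        have h1 : f x = f.contLinear x + f 0 := by
          have := f.map_vadd 0 x
          simpa using this
        have h2 := f.contLinear.le_opNorm x
        have h3 := f.norm_contLinear_le
        have h4 := f.norm_image_zero_le
        have h5 := norm_add_le (f.contLinear x) (f 0)
        have h6 := mul_le_mul_of_nonneg_right h3 (norm_nonneg x)
        simp only [LinearMap.coe_mk, AddHom.coe_mk, h1]
        linarith
  exact L.hasFDerivAt.comp_hasDerivAt t h

theorem dist_of_mem_isoGroup {f : X →ᴬ[ℝ] X} (hf : f ∈ isoGroup X) (x y : X) :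
    ‖f x - f y‖ = ‖x - y‖ := by
  obtain ⟨g, rfl⟩ := hf
  rw [← dist_eq_norm, ← dist_eq_norm]
  exact g.isometry.dist_eq x y

theorem edgeFunctional_of_velocity {p : V → X} {v w : V} (h : IsSmoothPoint (p v - p w))
    {a b : ℝ → X} {a' b' : X} (ha : HasDerivAt a a' 0) (hb : HasDerivAt b b' 0)
    (ha0 : a 0 = p v) (hb0 : b 0 = p w)
    (hab : ∀ᶠ t in 𝓝 (0 : ℝ), ‖a t - b t‖ = ‖p v - p w‖) :
    edgeFunctional p v w (a' - b') = 0 := by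
  have hs := dualMap_spec (isSmoothPoint_normalize h)
  have hpos : ‖p v - p w‖ ≠ 0 := norm_ne_zero_iff.mpr h.1
  have h1 : ‖‖p v - p w‖⁻¹ • (p v - p w)‖ = 1 := by
    rw [norm_smul, norm_inv, norm_norm, inv_mul_cancel₀ hpos]
  have hnorm : ‖edgeFunctional p v w‖ = 1 := hs.1.trans h1
  have hval : edgeFunctional p v w (p v - p w) = ‖p v - p w‖ := by
    have h2 := hs.2
    rw [h1, map_smul, smul_eq_mul, one_pow, inv_mul_eq_one₀ hpos] at h2
    exact h2.symm
  have hmax : IsLocalMax (fun t => edgeFunctional p v w (a t - b t)) 0 := by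
    filter_upwards [hab] with t ht
    rw [ha0, hb0, hval, ← ht]
    have := (le_abs_self _).trans ((edgeFunctional p v w).le_opNorm (a t - b t))
    rwa [hnorm, one_mul] at this
  exact hmax.hasDerivAt_eq_zero ((edgeFunctional p v w).hasFDerivAt.comp_hasDerivAt 0 (ha.sub hb))

theorem isFlex_of_mem_isoTangentSpace {G : SimpleGraph V} {p : V → X}
    (hp : IsWellPositioned G p) {A : X →ᴬ[ℝ] X} (hA : A ∈ isoTangentSpace X) :
    IsFlex G p fun v => A (p v) := by
  let L : (X →ᴬ[ℝ] X) →ₗ[ℝ] (V → X) :=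
    { toFun := fun f v => f (p v), map_add' := fun _ _ => rfl, map_smul' := fun _ _ => rfl }
  suffices isoTangentSpace X ≤ LinearMap.ker (rigidityOperator G p ∘ₗ L) from this hA
  refine Submodule.span_le.mpr ?_
  rintro B ⟨δ, γ, hδ, -, hγ, hγ0, hB⟩
  change rigidityOperator G p (L B) = 0
  ext ⟨e, he⟩
  induction e using Sym2.ind with
  | _ v w =>
    refine edgeFunctional_of_velocity (hp v w he) (hasDerivAt_apply_of_hasDerivAt hB (p v))
      (hasDerivAt_apply_of_hasDerivAt hB (p w)) (by simp [hγ0]) (by simp [hγ0]) ?_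
    filter_upwards [Ioo_mem_nhds (neg_lt_zero.mpr hδ) hδ] with t ht
    exact dist_of_mem_isoGroup (hγ t ht) _ _

theorem IsIndependent.finrank_ker [FiniteDimensional ℝ X] [Finite V] {G : SimpleGraph V}
    {p : V → X} (hp : IsIndependent G p) :
    G.edgeSet.ncard + Module.finrank ℝ (LinearMap.ker (rigidityOperator G p)) =
      Module.finrank ℝ X * Nat.card V := by
  have : Fintype V := Fintype.ofFinite V
  have : Fintype G.edgeSet := Fintype.ofFinite _
  have h := LinearMap.finrank_range_add_finrank_ker (rigidityOperator G p)
  rw [LinearMap.range_eq_top.mpr hp.2, finrank_top, Module.finrank_pi,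
    Module.finrank_pi_fintype, Finset.sum_const, Finset.card_univ, smul_eq_mul] at h
  rw [← Nat.card_coe_set_eq, Nat.card_eq_fintype_card, Nat.card_eq_fintype_card, h, mul_comm]

theorem IsIndependent.ncard_edgeSet_add_dimIso_le [FiniteDimensional ℝ X] [Finite V]
    {G : SimpleGraph V} {p : V → X} (hp : IsIndependent G p)
    (hV : Module.finrank ℝ X + 1 ≤ Nat.card V) :
    G.edgeSet.ncard + dimIso X ≤ Module.finrank ℝ X * Nat.card V := by
  have : Fintype V := Fintype.ofFinite V
  obtain ⟨q, hq, hspan⟩ := hp.exists_affinely_spanning hV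
  rw [← hq.finrank_ker]
  refine Nat.add_le_add_left ?_ _
  let L : isoTangentSpace X →ₗ[ℝ] LinearMap.ker (rigidityOperator G q) :=
    { toFun := fun A => ⟨fun v => A.1 (q v), isFlex_of_mem_isoTangentSpace hq.1 A.2⟩
      map_add' := fun _ _ => rfl
      map_smul' := fun _ _ => rfl }
  refine LinearMap.finrank_le_finrank_of_injective (f := L) ?_
  refine LinearMap.ker_eq_bot.mp (LinearMap.ker_eq_bot'.mpr fun A hA => ?_)
  exact Subtype.ext (hspan A.1 fun v => congrFun (congrArg Subtype.val hA) v)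

theorem IsIndependent.coe_subgraph {G : SimpleGraph V} {p : V → X} (hp : IsIndependent G p)
    (H : G.Subgraph) : IsIndependent H.coe fun v => p v := by
  classical
  refine ⟨fun v w h => hp.1 v w (H.adj_sub h), fun y => ?_⟩
  let ι : H.coe.edgeSet → G.edgeSet := H.hom.mapEdgeSet
  have hι : Function.Injective ι := SimpleGraph.Hom.mapEdgeSet.injective _ H.hom_injective
  obtain ⟨x, hx⟩ := hp.2 (Function.extend ι y 0)
  refine ⟨fun v => x v, ?_⟩
  ext e
  rw [← hι.extend_apply y 0 e, ← hx]
  obtain ⟨e, he⟩ := e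
  induction e using Sym2.ind with
  | _ v w => rfl

theorem ncard_edgeSet_coe {G : SimpleGraph V} (H : G.Subgraph) :
    H.coe.edgeSet.ncard = H.edgeSet.ncard := by
  rw [← SimpleGraph.Subgraph.image_coe_edgeSet_coe,
    Set.ncard_image_of_injective _ (Sym2.map.injective Subtype.val_injective)]

end UpperBound

section LinearIsometries

variable {X : Type*} [NormedAddCommGroup X] [NormedSpace ℝ X]

variable (X) in
/-- The set of norm-preserving continuous linear endomorphisms. -/
def linearIsometries : Set (X →L[ℝ] X) := {T | ∀ x, ‖T x‖ = ‖x‖}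

theorem linearIsometries_mul {S T : X →L[ℝ] X} (hS : S ∈ linearIsometries X)
    (hT : T ∈ linearIsometries X) : S * T ∈ linearIsometries X :=
  fun x => (hS (T x)).trans (hT x)

theorem exists_inverse_of_mem_linearIsometries [FiniteDimensional ℝ X] {T : X →L[ℝ] X}
    (hT : T ∈ linearIsometries X) :
    ∃ M ∈ linearIsometries X, T * M = 1 ∧ M * T = 1 := by
  have hinj : Function.Injective T := by
    refine (injective_iff_map_eq_zero T).mpr fun x hx => ?_
    rw [← norm_eq_zero, ← hT x, hx, norm_zero]
  obtain ⟨u, rfl⟩ := isUnit_of_injective hinj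
  refine ⟨↑u⁻¹, fun x => ?_, u.mul_inv, u.inv_mul⟩
  rw [← hT, ← mul_apply_eq_comp, u.mul_inv, one_apply_eq_self]

theorem isCompact_linearIsometries [FiniteDimensional ℝ X] : IsCompact (linearIsometries X) := by
  have : ProperSpace (X →L[ℝ] X) := FiniteDimensional.proper ℝ _
  refine Metric.isCompact_of_isClosed_isBounded ?_ ?_
  · have : linearIsometries X = ⋂ x, {T | ‖T x‖ = ‖x‖} := by
      ext T
      simp [linearIsometries]
    rw [this]
    exact isClosed_iInter fun x => isClosed_eq (by fun_prop) continuous_const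
  · refine isBounded_iff_forall_norm_le.mpr ⟨1, fun T hT => ?_⟩
    exact T.opNorm_le_bound zero_le_one fun x => by rw [hT x, one_mul]

theorem tendsto_exp_slope [CompleteSpace X] (A : X →L[ℝ] X) {ε : ℕ → ℝ}
    (hε : ∀ᶠ n in atTop, ε n ≠ 0) (hε0 : Tendsto ε atTop (𝓝 0)) :
    Tendsto (fun n => (ε n)⁻¹ • (NormedSpace.exp (ε n • A) - 1)) atTop (𝓝 A) := by
  have h := hasDerivAt_exp_smul_const (𝕂 := ℝ) A (0 : ℝ)
  rw [hasDerivAt_iff_tendsto_slope_zero] at h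
  simpa [Function.comp_def] using h.comp (tendsto_nhdsWithin_iff.mpr ⟨hε0, hε⟩)

theorem exp_add_smul_apply [CompleteSpace X] (A : X →L[ℝ] X) (s t : ℝ) (x : X) :
    NormedSpace.exp ((s + t) • A) x = NormedSpace.exp (s • A) (NormedSpace.exp (t • A) x) := by
  let : NormedAlgebra ℚ (X →L[ℝ] X) := NormedAlgebra.restrictScalars ℚ ℝ _
  rw [add_smul, NormedSpace.exp_add_of_commute
    (((Commute.refl A).smul_left s).smul_right t), mul_apply_eq_comp]

theorem exp_smul_apply_of_apply_eq_zero [CompleteSpace X] {A : X →L[ℝ] X} {x : X} (h : A x = 0)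
    (t : ℝ) : NormedSpace.exp (t • A) x = x := by
  have hd : ∀ s : ℝ, HasDerivAt (fun s : ℝ => NormedSpace.exp (s • A) x) 0 s := by
    intro s
    have h1 := (ContinuousLinearMap.apply ℝ X x).hasFDerivAt.comp_hasDerivAt s
      (hasDerivAt_exp_smul_const (𝕂 := ℝ) A s)
    simpa [Function.comp_def, h] using h1
  have := is_const_of_deriv_eq_zero (fun s => (hd s).differentiableAt) (fun s => (hd s).deriv) t 0
  simpa using this

/-- Limits of difference quotients of linear isometries at the identity generate one-parameter
groups of linear isometries. -/
theorem exp_mem_linearIsometries [CompleteSpace X] {g : ℕ → X →L[ℝ] X}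
    (hg : ∀ n, g n ∈ linearIsometries X) {ε : ℕ → ℝ} (hε : ∀ᶠ n in atTop, 0 < ε n)
    (hε0 : Tendsto ε atTop (𝓝 0)) {A : X →L[ℝ] X}
    (hA : Tendsto (fun n => (ε n)⁻¹ • (g n - 1)) atTop (𝓝 A)) (t : ℝ) :
    NormedSpace.exp (t • A) ∈ linearIsometries X := by
  have hslope : ∀ y : X, Tendsto
      (fun n => (ε n)⁻¹ * (‖NormedSpace.exp (ε n • A) y‖ - ‖y‖)) atTop (𝓝 0) := by
    intro y
    have h1 : Tendsto (fun n => ‖(ε n)⁻¹ • (NormedSpace.exp (ε n • A) - 1) -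
        (ε n)⁻¹ • (g n - 1)‖ * ‖y‖) atTop (𝓝 0) := by
      have := (((tendsto_exp_slope A (hε.mono fun _ h => h.ne') hε0).sub hA).norm).mul_const ‖y‖
      simpa using this
    refine squeeze_zero_norm (fun n => ?_) h1
    have h2 := abs_norm_sub_norm_le (NormedSpace.exp (ε n • A) y) (g n y)
    rw [hg n y] at h2
    have h3 : (ε n)⁻¹ • (NormedSpace.exp (ε n • A) - 1) - (ε n)⁻¹ • (g n - 1) =
        (ε n)⁻¹ • (NormedSpace.exp (ε n • A) - g n) := by module
    rw [h3, norm_smul, norm_mul, mul_assoc, Real.norm_eq_abs (_ - _)]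
    refine mul_le_mul_of_nonneg_left (h2.trans ?_) (norm_nonneg _)
    exact ContinuousLinearMap.le_opNorm (NormedSpace.exp (ε n • A) - g n) y
  have hcont : ∀ x : X, Continuous fun s : ℝ => ‖NormedSpace.exp (s • A) x‖ := fun x =>
    continuous_iff_continuousAt.mpr fun s =>
      ((ContinuousLinearMap.apply ℝ X x).continuous.continuousAt.comp
        (hasDerivAt_exp_smul_const (𝕂 := ℝ) A s).continuousAt).norm
  have hpos : ∀ s : ℝ, 0 ≤ s → ∀ x : X, ‖NormedSpace.exp (s • A) x‖ = ‖x‖ := by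
    intro s hs x
    have hlim : ∀ r : ℝ, Tendsto (fun n => slope (fun s : ℝ => ‖NormedSpace.exp (s • A) x‖) r
        (r + ε n)) atTop (𝓝 0) := by
      intro r
      refine (hslope (NormedSpace.exp (r • A) x)).congr fun n => ?_
      rw [slope_def_field, add_sub_cancel_left, add_comm r, exp_add_smul_apply, div_eq_inv_mul]
    have hright : ∀ r : ℝ, Tendsto (fun n => r + ε n) atTop (𝓝[>] r) := fun r =>
      tendsto_nhdsWithin_iff.mpr ⟨by simpa using hε0.const_add r, by
        filter_upwards [hε] with n hn
        exact lt_add_of_pos_right r hn⟩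
    refine le_antisymm ?_ ?_
    · refine image_le_of_liminf_slope_right_le_deriv_boundary (a := 0) (b := s)
        (B := fun _ => ‖x‖) (B' := 0) (f := fun s : ℝ => ‖NormedSpace.exp (s • A) x‖)
        (hcont x).continuousOn (by simp)
        continuousOn_const (fun r _ => hasDerivWithinAt_const _ _ _) (fun r _ c hc => ?_)
        ⟨hs, le_rfl⟩
      exact (hright r).frequently ((hlim r).eventually (gt_mem_nhds hc)).frequently
    · refine neg_le_neg_iff.mp ?_
      refine image_le_of_liminf_slope_right_le_deriv_boundary (a := 0) (b := s)
        (B := fun _ => -‖x‖) (B' := 0) (f := fun s : ℝ => -‖NormedSpace.exp (s • A) x‖)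
        (hcont x).neg.continuousOn (by simp)
        continuousOn_const (fun r _ => hasDerivWithinAt_const _ _ _) (fun r _ c hc => ?_)
        ⟨hs, le_rfl⟩
      have hlim' := (hlim r).neg
      rw [neg_zero] at hlim'
      refine (hright r).frequently (((hlim'.eventually (gt_mem_nhds hc)).mono ?_).frequently)
      intro n hn
      simpa [slope_def_field, ← neg_div, neg_add_eq_sub] using hn
  intro x
  rcases le_total 0 t with ht | ht
  · exact hpos t ht x
  · have h := hpos (-t) (neg_nonneg.mpr ht) (NormedSpace.exp (t • A) x)
    rw [← exp_add_smul_apply, neg_add_cancel, zero_smul, NormedSpace.exp_zero,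
      one_apply_eq_self] at h
    exact h.symm

/-- If linear isometries `L n` move the points `p v` by less and less, then along a subsequence
their actions on `p` are realized by linear isometries that tend to the identity and are closest
possible to it. -/
theorem exists_minimal_representatives [FiniteDimensional ℝ X] {V : Type*} {p : V → X}
    {L : ℕ → X →L[ℝ] X} (hL : ∀ n, L n ∈ linearIsometries X)
    (hp : ∀ v, Tendsto (fun n => L n (p v)) atTop (𝓝 (p v))) :
    ∃ (φ : ℕ → ℕ) (g : ℕ → X →L[ℝ] X), StrictMono φ ∧ (∀ n, g n ∈ linearIsometries X) ∧
      (∀ n v, g n (p v) = L (φ n) (p v)) ∧ Tendsto g atTop (𝓝 1) ∧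
      ∀ n, ∀ h ∈ linearIsometries X, (∀ v, h (p v) = g n (p v)) → ‖g n - 1‖ ≤ ‖h - 1‖ := by
  obtain ⟨L₀, hL₀, φ, hφ, hlim⟩ := isCompact_linearIsometries.tendsto_subseq hL
  obtain ⟨M, hM, hLM, hML⟩ := exists_inverse_of_mem_linearIsometries hL₀
  have hfix : ∀ v, L₀ (p v) = p v := fun v =>
    tendsto_nhds_unique (((ContinuousLinearMap.apply ℝ X (p v)).continuous.tendsto _).comp hlim)
      ((hp v).comp hφ.tendsto_atTop)
  have hfixM : ∀ v, M (p v) = p v := fun v => by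
    conv_lhs => rw [← hfix v]
    rw [← mul_apply_eq_comp, hML, one_apply_eq_self]
  have hmin : ∀ n, ∃ g ∈ linearIsometries X ∩ {T | ∀ v, T (p v) = L (φ n) (p v)},
      ∀ h ∈ linearIsometries X ∩ {T | ∀ v, T (p v) = L (φ n) (p v)}, ‖g - 1‖ ≤ ‖h - 1‖ := by
    intro n
    have hne : (linearIsometries X ∩ {T | ∀ v, T (p v) = L (φ n) (p v)}).Nonempty :=
      ⟨L (φ n), hL _, fun v => rfl⟩
    refine IsCompact.exists_isMinOn (f := fun T : X →L[ℝ] X => ‖T - 1‖)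
      (isCompact_linearIsometries.inter_right ?_) hne (by fun_prop)
    have : {T : X →L[ℝ] X | ∀ v, T (p v) = L (φ n) (p v)} =
        ⋂ v, {T | T (p v) = L (φ n) (p v)} := by
      ext T
      simp
    rw [this]
    exact isClosed_iInter fun v => isClosed_eq (by fun_prop) continuous_const
  choose g hg hgmin using hmin
  refine ⟨φ, g, hφ, fun n => (hg n).1, fun n => (hg n).2, ?_, fun n h hh hhp =>
    hgmin n h ⟨hh, fun v => (hhp v).trans ((hg n).2 v)⟩⟩
  rw [tendsto_iff_norm_sub_tendsto_zero]
  have h1 : Tendsto (fun n => ‖L (φ n) * M - 1‖) atTop (𝓝 0) := by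
    have h2 : Tendsto (fun n => L (φ n) * M) atTop (𝓝 1) := hLM ▸ hlim.mul_const M
    exact tendsto_iff_norm_sub_tendsto_zero.mp h2
  refine squeeze_zero (fun _ => norm_nonneg _) (fun n => ?_) h1
  refine hgmin n _ ⟨linearIsometries_mul (hL _) hM, fun v => ?_⟩
  rw [mul_apply_eq_comp, hfixM]

theorem exists_generator_of_minimal [FiniteDimensional ℝ X] {V : Type*} {p u : V → X}
    {g : ℕ → X →L[ℝ] X} (hg : ∀ n, g n ∈ linearIsometries X) (hg1 : Tendsto g atTop (𝓝 1))
    (hmin : ∀ n, ∀ h ∈ linearIsometries X, (∀ v, h (p v) = g n (p v)) → ‖g n - 1‖ ≤ ‖h - 1‖)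
    {t : ℕ → ℝ} (ht : ∀ n, 0 < t n) (ht0 : Tendsto t atTop (𝓝 0))
    (hu : ∀ v, Tendsto (fun n => (t n)⁻¹ • (g n (p v) - p v)) atTop (𝓝 (u v))) :
    ∃ A : X →L[ℝ] X, (∀ s : ℝ, NormedSpace.exp (s • A) ∈ linearIsometries X) ∧
      ∀ v, A (p v) = u v := by
  have : CompleteSpace X := FiniteDimensional.complete ℝ X
  have : ProperSpace (X →L[ℝ] X) := FiniteDimensional.proper ℝ _
  by_cases hb : ∃ R, ∃ᶠ n in atTop, (t n)⁻¹ • (g n - 1) ∈ Metric.closedBall (0 : X →L[ℝ] X) R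
  · obtain ⟨R, hR⟩ := hb
    obtain ⟨A, -, φ, hφ, hA⟩ := tendsto_subseq_of_frequently_bounded Metric.isBounded_closedBall hR
    refine ⟨A, exp_mem_linearIsometries (fun n => hg (φ n))
      (Eventually.of_forall fun n => ht (φ n)) (ht0.comp hφ.tendsto_atTop) hA, fun v => ?_⟩
    exact tendsto_nhds_unique
      (((ContinuousLinearMap.apply ℝ X (p v)).continuous.tendsto _).comp hA)
      ((hu v).comp hφ.tendsto_atTop)
  · exfalso
    have htop : Tendsto (fun n => ‖(t n)⁻¹ • (g n - 1)‖) atTop atTop := by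
      refine tendsto_atTop.mpr fun R => ?_
      have h1 : ∀ᶠ n in atTop, (t n)⁻¹ • (g n - 1) ∉ Metric.closedBall (0 : X →L[ℝ] X) R :=
        not_frequently.mp (not_exists.mp hb R)
      filter_upwards [h1] with n hn
      rw [mem_closedBall_zero_iff, not_le] at hn
      exact hn.le
    have hε : ∀ᶠ n in atTop, 0 < ‖g n - 1‖ := by
      filter_upwards [htop.eventually (eventually_gt_atTop 0)] with n hn
      rw [norm_smul] at hn
      exact pos_of_mul_pos_right hn (norm_nonneg _)
    have hε0 : Tendsto (fun n => ‖g n - 1‖) atTop (𝓝 0) :=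
      tendsto_iff_norm_sub_tendsto_zero.mp hg1
    have hbd : ∀ n, ‖g n - 1‖⁻¹ • (g n - 1) ∈ Metric.closedBall (0 : X →L[ℝ] X) 1 := by
      intro n
      rw [mem_closedBall_zero_iff, norm_smul, norm_inv, norm_norm]
      exact inv_mul_le_one
    obtain ⟨A, -, φ, hφ, hA⟩ := tendsto_subseq_of_bounded Metric.isBounded_closedBall hbd
    have hφ' := hφ.tendsto_atTop
    have hexp := exp_mem_linearIsometries (fun n => hg (φ n)) (hφ'.eventually hε)
      (hε0.comp hφ') hA
    have hAp : ∀ v, A (p v) = 0 := by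
      intro v
      have h1 : Tendsto (fun n => ‖(t n)⁻¹ • (g n - 1)‖⁻¹ • ((t n)⁻¹ • (g n (p v) - p v))) atTop
          (𝓝 0) := by
        simpa using htop.inv_tendsto_atTop.smul (hu v)
      refine tendsto_nhds_unique
        (((ContinuousLinearMap.apply ℝ X (p v)).continuous.tendsto _).comp hA)
        ((h1.comp hφ').congr fun n => ?_)
      have htn := ht (φ n)
      simp only [Function.comp_apply, ContinuousLinearMap.apply_apply, smul_apply,
        sub_apply, one_apply_eq_self, norm_smul, norm_inv, Real.norm_eq_abs, abs_of_pos htn,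
        smul_smul]
      congr 1
      field_simp
    have hlim : Tendsto (fun n => ‖g (φ n) - 1‖⁻¹ •
        (g (φ n) * NormedSpace.exp ((-‖g (φ n) - 1‖) • A) - 1)) atTop (𝓝 0) := by
      have h1 := tendsto_exp_slope (-A) ((hφ'.eventually hε).mono fun _ h => h.ne')
        (hε0.comp hφ')
      have h2 : Tendsto (fun n => NormedSpace.exp ((-‖g (φ n) - 1‖) • A)) atTop (𝓝 1) := by
        have h3 := (hasDerivAt_exp_smul_const (𝕂 := ℝ) A (0 : ℝ)).continuousAt.tendsto
        rw [zero_smul, NormedSpace.exp_zero] at h3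
        have h4 := (hε0.comp hφ').neg
        rw [neg_zero] at h4
        exact h3.comp h4
      have h5 := (hA.mul h2).add h1
      rw [mul_one, add_neg_cancel] at h5
      refine h5.congr fun n => ?_
      simp only [Function.comp_apply, smul_neg, neg_smul, smul_mul_assoc, sub_mul, one_mul]
      module
    have hge : ∀ᶠ n in atTop, 1 ≤ ‖‖g (φ n) - 1‖⁻¹ •
        (g (φ n) * NormedSpace.exp ((-‖g (φ n) - 1‖) • A) - 1)‖ := by
      filter_upwards [hφ'.eventually hε] with n hn
      have h1 := hmin (φ n) _ (linearIsometries_mul (hg (φ n)) (hexp (-‖g (φ n) - 1‖)))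
        fun v => by rw [mul_apply_eq_comp, exp_smul_apply_of_apply_eq_zero (hAp v)]
      rw [norm_smul, norm_inv, norm_norm]
      rwa [le_inv_mul_iff₀ hn, mul_one]
    have := ge_of_tendsto hlim.norm hge
    rw [norm_zero] at this
    exact absurd this (by norm_num)

/-- A velocity of linear isometries acting on a placement is induced by the generator of a
one-parameter group of linear isometries. -/
theorem exists_generator [FiniteDimensional ℝ X] {V : Type*} {p u : V → X}
    {L : ℕ → X →L[ℝ] X} (hL : ∀ n, L n ∈ linearIsometries X)
    {t : ℕ → ℝ} (ht : ∀ n, 0 < t n) (ht0 : Tendsto t atTop (𝓝 0))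
    (hu : ∀ v, Tendsto (fun n => (t n)⁻¹ • (L n (p v) - p v)) atTop (𝓝 (u v))) :
    ∃ A : X →L[ℝ] X, (∀ s : ℝ, NormedSpace.exp (s • A) ∈ linearIsometries X) ∧
      ∀ v, A (p v) = u v := by
  have hp : ∀ v, Tendsto (fun n => L n (p v)) atTop (𝓝 (p v)) := by
    intro v
    have h1 := (ht0.smul (hu v)).add_const (p v)
    rw [zero_smul, zero_add] at h1
    refine h1.congr fun n => ?_
    rw [smul_inv_smul₀ (ht n).ne', sub_add_cancel]
  obtain ⟨φ, g, hφ, hg, hgL, hg1, hmin⟩ := exists_minimal_representatives hL hp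
  refine exists_generator_of_minimal hg hg1 hmin (fun n => ht (φ n))
    (ht0.comp hφ.tendsto_atTop) fun v => ?_
  simp only [hgL]
  exact (hu v).comp hφ.tendsto_atTop

end LinearIsometries

section TrivialMotions

variable {X : Type*} [NormedAddCommGroup X] [NormedSpace ℝ X] {V : Type*}

instance [FiniteDimensional ℝ X] : FiniteDimensional ℝ (X →ᴬ[ℝ] X) :=
  (ContinuousAffineMap.decompLinearIsometryEquiv ℝ ℝ X X).symm.toLinearEquiv.finiteDimensional

theorem mem_isoGroup_of_mem_linearIsometries [FiniteDimensional ℝ X] {T : X →L[ℝ] X}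
    (hT : T ∈ linearIsometries X) (c : X) :
    (ContinuousAffineMap.decompLinearIsometryEquiv ℝ ℝ X X).symm (c, T) ∈ isoGroup X := by
  let e : X ≃ₗᵢ[ℝ] X := LinearIsometry.toLinearIsometryEquiv ⟨T.toLinearMap, hT⟩ rfl
  refine ⟨e.toIsometryEquiv.trans (IsometryEquiv.addRight c), ?_⟩
  ext x
  rfl

/-- The affine velocity field with value `c` at `x₀` whose linear part generates linear
isometries is tangent to the isometry group. -/
theorem exists_mem_isoTangentSpace [FiniteDimensional ℝ X] {A : X →L[ℝ] X}
    (hA : ∀ s : ℝ, NormedSpace.exp (s • A) ∈ linearIsometries X) (x₀ c : X) :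
    ∃ B ∈ isoTangentSpace X, ∀ x, B x = A (x - x₀) + c := by
  have : CompleteSpace X := FiniteDimensional.complete ℝ X
  let Φ := (ContinuousAffineMap.decompLinearIsometryEquiv ℝ ℝ X X).symm
  let η : ℝ → X × (X →L[ℝ] X) := fun s =>
    (s • c + x₀ - NormedSpace.exp (s • A) x₀, NormedSpace.exp (s • A))
  have hexp : ContDiff ℝ (⊤ : ℕ∞) fun s : ℝ => NormedSpace.exp (s • A) := by
    have h1 : ContDiff ℝ (⊤ : ℕ∞) (NormedSpace.exp : (X →L[ℝ] X) → (X →L[ℝ] X)) :=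
      contDiff_iff_contDiffAt.mpr fun T => (NormedSpace.exp_analytic (𝕂 := ℝ) T).contDiffAt
    exact h1.comp (contDiff_id.smul contDiff_const)
  have hη : ContDiff ℝ (⊤ : ℕ∞) η :=
    (((contDiff_id.smul contDiff_const).add contDiff_const).sub
      (hexp.clm_apply contDiff_const)).prodMk hexp
  have hdexp : HasDerivAt (fun s : ℝ => NormedSpace.exp (s • A)) A 0 := by
    simpa using hasDerivAt_exp_smul_const (𝕂 := ℝ) A (0 : ℝ)
  have hdη : HasDerivAt η (c - A x₀, A) 0 := by
    have h1 := (ContinuousLinearMap.apply ℝ X x₀).hasFDerivAt.comp_hasDerivAt 0 hdexp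
    have h2 : HasDerivAt (fun s : ℝ => s • c + x₀) c 0 := by
      simpa using ((hasDerivAt_id (0 : ℝ)).smul_const c).add_const x₀
    exact (h2.sub h1).prodMk hdexp
  refine ⟨Φ (c - A x₀, A), Submodule.subset_span ⟨1, fun s => Φ (η s), one_pos, ?_, ?_, ?_, ?_⟩, ?_⟩
  · exact (Φ.toContinuousLinearEquiv.contDiff.comp hη).contDiffOn
  · exact fun s _ => mem_isoGroup_of_mem_linearIsometries (hA s) _
  · ext x
    simp [Φ, η]
  · exact Φ.toContinuousLinearEquiv.hasFDerivAt.comp_hasDerivAt 0 hdη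
  · intro x
    simp only [Φ, ContinuousAffineMap.decompLinearIsometryEquiv_symm_apply, map_sub]
    abel

theorem IsTrivialMotion.exists_mem_isoTangentSpace [FiniteDimensional ℝ X] [Nonempty V]
    {p u : V → X} (h : IsTrivialMotion p u) :
    ∃ B ∈ isoTangentSpace X, ∀ v, B (p v) = u v := by
  obtain ⟨δ, α, ⟨hδ, -, hα0, hα⟩, hu⟩ := h
  obtain ⟨o⟩ := ‹Nonempty V›
  let t : ℕ → ℝ := fun n => δ / (n + 2)
  have ht : ∀ n, 0 < t n := fun n => by positivity
  have ht0 : Tendsto t atTop (𝓝 0) := tendsto_const_nhds.div_atTop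
    (tendsto_natCast_atTop_atTop.atTop_add tendsto_const_nhds)
  have htδ : ∀ n, t n ∈ Set.Ioo (-δ) δ := fun n =>
    ⟨(neg_lt_zero.mpr hδ).trans (ht n), div_lt_self hδ (by
      have : (0 : ℝ) ≤ n := n.cast_nonneg
      linarith)⟩
  choose g hg using fun n => hα (t n) (htδ n)
  let L : ℕ → X →L[ℝ] X := fun n =>
    (g n).toRealAffineIsometryEquiv.linearIsometryEquiv.toContinuousLinearEquiv
  have hL : ∀ n, L n ∈ linearIsometries X := fun n x =>
    (g n).toRealAffineIsometryEquiv.linearIsometryEquiv.norm_map x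
  have hLg : ∀ n x y, L n (x - y) = g n x - g n y := fun n x y =>
    ((g n).toRealAffineIsometryEquiv.map_vsub x y)
  have hlim : ∀ v, Tendsto (fun n => (t n)⁻¹ • (α v (t n) - p v)) atTop (𝓝 (u v)) := by
    intro v
    have h1 := (hasDerivAt_iff_tendsto_slope_zero.mp (hu v)).comp
      (tendsto_nhdsWithin_iff.mpr ⟨ht0, Eventually.of_forall fun n => (ht n).ne'⟩)
    simpa [Function.comp_def, hα0] using h1
  obtain ⟨A, hA, hAu⟩ := exists_generator (p := fun v => p v - p o) (u := fun v => u v - u o)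
    hL ht ht0 fun v => by
      refine ((hlim v).sub (hlim o)).congr fun n => ?_
      rw [hLg, ← hg n v, ← hg n o]
      module
  obtain ⟨B, hB, hBx⟩ := NormedRigidity.exists_mem_isoTangentSpace hA (p o) (u o)
  exact ⟨B, hB, fun v => by rw [hBx, hAu, sub_add_cancel]⟩

theorem IsIsostatic.finrank_mul_card_le [FiniteDimensional ℝ X] [Finite V] [Nonempty V]
    {G : SimpleGraph V} {p : V → X} (h : IsIsostatic G p) :
    Module.finrank ℝ X * Nat.card V ≤ G.edgeSet.ncard + dimIso X := by
  have : Fintype V := Fintype.ofFinite V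
  rw [← h.2.finrank_ker]
  refine Nat.add_le_add_left ?_ _
  let L : isoTangentSpace X →ₗ[ℝ] (V → X) :=
    { toFun := fun A v => A.1 (p v), map_add' := fun _ _ => rfl, map_smul' := fun _ _ => rfl }
  refine (Submodule.finrank_mono fun u hu => ?_).trans L.finrank_range_le
  obtain ⟨B, hB, hBu⟩ := (h.1.2 u hu).exists_mem_isoTangentSpace
  exact ⟨⟨B, hB⟩, funext hBu⟩

end TrivialMotions

end NormedRigidity

theorem mainTheorem6 {X : Type*} [NormedAddCommGroup X] [NormedSpace ℝ X] [FiniteDimensional ℝ X]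
    {V : Type*} [Finite V] (G : SimpleGraph V) (p : V → X)
    (hV : Module.finrank ℝ X + 1 ≤ Nat.card V) (hp : NormedRigidity.IsIndependent G p) :
    (∀ H : G.Subgraph, Module.finrank ℝ X + 1 ≤ H.verts.ncard →
      (H.edgeSet.ncard : ℤ) ≤
        (Module.finrank ℝ X : ℤ) * (H.verts.ncard : ℤ) - (NormedRigidity.dimIso X : ℤ)) ∧
    (NormedRigidity.IsIsostatic G p →
      (G.edgeSet.ncard : ℤ) =
        (Module.finrank ℝ X : ℤ) * (Nat.card V : ℤ) - (NormedRigidity.dimIso X : ℤ)) := by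
  refine ⟨fun H hH => ?_, fun hiso => ?_⟩
  · have h := (hp.coe_subgraph H).ncard_edgeSet_add_dimIso_le
      (by rwa [Nat.card_coe_set_eq])
    rw [NormedRigidity.ncard_edgeSet_coe, Nat.card_coe_set_eq] at h
    zify at h
    linarith
  · have : Nonempty V := (Nat.card_pos_iff.mp (by omega)).1
    have h1 := hp.ncard_edgeSet_add_dimIso_le hV
    have h2 := hiso.finrank_mul_card_le
    zify at h1 h2
    linarith
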